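/- For a finite group $G$ let $\pi_e(G)=\{\operatorname{ord}(g) : g\in G\}$ be the set of orders of its elements, and for odd $n\ge 3$ let $Sz(2^n)$ be the Suzuki group over the field with $2^n$ elements. If $p$ and $q$ are distinct odd primes, then $$\pi_e(Sz(2^p))\cap\pi_e(Sz(2^q))=\{1,2,4,5\}.$$ -/

import Mathlib

open scoped MatrixGroups

/-- The set `π_e(G)` of orders of elements of a group `G` (for finite `G`, all orders are
positive). -/
def elementOrders (G : Type*) [Group G] : Set ℕ := Set.range (orderOf : G → ℕ)

namespace Suzuki

/-- The lower unitriangular matrix `S(a, b)`, with rows `(1, 0, 0, 0)`, `(a, 1, 0, 0)`,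
`(b, θ a, 1, 0)`, `(a ^ 2 * θ a + a * b + θ b, a * θ a + b, a, 1)`, where
`θ x = x ^ (2 ^ (m + 1))`. -/
def S {K : Type*} [Field K] (m : ℕ) (a b : K) : SL(4, K) :=
  ⟨!![1, 0, 0, 0;
      a, 1, 0, 0;
      b, a ^ 2 ^ (m + 1), 1, 0;
      a ^ 2 * a ^ 2 ^ (m + 1) + a * b + b ^ 2 ^ (m + 1), a * a ^ 2 ^ (m + 1) + b, a, 1], by
    simp [Matrix.det_succ_row_zero, Fin.sum_univ_succ]⟩

/-- The diagonal matrix `M(c)` with diagonal entries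
`c ^ (1 + 2 ^ m), c ^ (2 ^ m), c ^ (-2 ^ m), c ^ (-1 - 2 ^ m)`, for `c ≠ 0`. -/
def M {K : Type*} [Field K] (m : ℕ) (c : Kˣ) : SL(4, K) :=
  ⟨Matrix.diagonal ![(c : K) ^ (1 + 2 ^ m), (c : K) ^ 2 ^ m,
      ((c : K) ^ 2 ^ m)⁻¹, ((c : K) ^ (1 + 2 ^ m))⁻¹], by
    have hc : (c : K) ≠ 0 := c.ne_zero
    rw [Matrix.det_diagonal]
    simp only [Fin.prod_univ_four, Matrix.cons_val]
    field_simp⟩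

/-- The antidiagonal matrix `T` with entries `1`. -/
def T {K : Type*} [Field K] : SL(4, K) :=
  ⟨!![0, 0, 0, 1;
      0, 0, 1, 0;
      0, 1, 0, 0;
      1, 0, 0, 0], by
    simp [Matrix.det_succ_row_zero, Fin.sum_univ_succ, Fin.succAbove]
    norm_num⟩

end Suzuki

/-- The Suzuki group `Sz(2 ^ n)`, for odd `n = 2 * m + 1` (so `m = n / 2`), as the group of
`4 × 4` matrices over the field with `2 ^ n` elements generated by all `S(a, b)`, all `M(c)`
with `c ≠ 0`, and `T`. The map `θ : x ↦ x ^ (2 ^ (m + 1))` is the automorphism of the field with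
`θ ∘ θ` the Frobenius map `x ↦ x ^ 2`. -/
noncomputable def Sz (n : ℕ) : Subgroup SL(4, GaloisField 2 n) :=
  Subgroup.closure
    ({g | ∃ a b : GaloisField 2 n, g = Suzuki.S (n / 2) a b} ∪
      {g | ∃ c : (GaloisField 2 n)ˣ, g = Suzuki.M (n / 2) c} ∪ {Suzuki.T})

/-! Write `r = 2 ^ (m + 1)` and `Q = 2 ^ n`, `n = 2 * m + 1`. The relations `IsTwisted` hold for the
generators and survive products, so every element with trace `s` has characteristic polynomial `X^4
- s X^3 + s^r X^2 - s X + 1` (`IsTwisted.charpoly_eq`). If `s = 0` this is `X^4 - 1`. Otherwise it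
has distinct roots `α^±1`, `β^±1`, and comparing their `r`-th powers with `(αβ)^±1`, `(α/β)^±1`
shows that it divides `X^(Q-1) - 1` or `X^(Q^2+1) - 1` (`dvd_X_pow_sub_one`). So each order divides
4, or is a divisor of `2^(4n) - 1` prime to 3. For distinct primes `p`, `q` the gcd of `2^(4p) - 1`
and `2^(4q) - 1` is 15, which leaves only 1 and 5 besides the divisors of 4. Explicit matrices
realize all four orders. -/

open Polynomial

namespace Suzuki

/-- The polynomial relations satisfied by the matrices of a Suzuki group: they preserve the
alternating form of `T`, and their action on the exterior square induces on a four-dimensional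
subquotient the twist by `θ` of the natural module. -/
structure IsTwisted {K : Type*} [Field K] (θ : K →+* K) (A : Matrix (Fin 4) (Fin 4) K) : Prop where
  form : A * (T : SL(4, K)).1 * A.transpose = (T : SL(4, K)).1
  minor : ∀ i j : Fin 4,
    A (![0, 0, 1, 2] i) (![0, 0, 1, 2] j) * A (![1, 2, 3, 3] i) (![1, 2, 3, 3] j) -
      A (![0, 0, 1, 2] i) (![1, 2, 3, 3] j) * A (![1, 2, 3, 3] i) (![0, 0, 1, 2] j) = θ (A i j)

/-! ### The twisted relations: closure under products and the generators -/

section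
variable {K : Type*} [Field K]

theorem T_mul_T : (T : SL(4, K)).1 * (T : SL(4, K)).1 = 1 := by
  ext i j
  fin_cases i <;> fin_cases j <;> simp [T, Matrix.mul_apply, Fin.sum_univ_four]

theorem form_apply (A : Matrix (Fin 4) (Fin 4) K) (i j : Fin 4) :
    (A * (T : SL(4, K)).1 * A.transpose) i j =
      A i 3 * A j 0 + A i 2 * A j 1 + A i 1 * A j 2 + A i 0 * A j 3 := by
  simp [T, Matrix.mul_apply, Fin.sum_univ_four]

namespace IsTwisted
variable {θ : K →+* K} {A B : Matrix (Fin 4) (Fin 4) K}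

theorem inv_eq (hA : IsTwisted θ A) :
    ((T : SL(4, K)).1 * A.transpose * (T : SL(4, K)).1) * A = 1 := by
  apply mul_eq_one_comm.mp
  rw [← mul_assoc, ← mul_assoc, hA.form, T_mul_T]

theorem form' (hA : IsTwisted θ A) :
    A.transpose * (T : SL(4, K)).1 * A.transpose.transpose = (T : SL(4, K)).1 := by
  have h := congrArg ((T : SL(4, K)).1 * ·) hA.inv_eq
  simp only [← mul_assoc, T_mul_T, one_mul, mul_one] at h
  simpa using h

/-- Cauchy–Binet expands a minor of `A * B` over six index pairs. The pairs `{0,3}` and `{1,2}`,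
absent from `minor`, contribute terms that cancel by the form relations. -/
theorem mul [CharP K 2] (hA : IsTwisted θ A) (hB : IsTwisted θ B) : IsTwisted θ (A * B) := by
  refine ⟨?_, fun i j ↦ ?_⟩
  · rw [Matrix.transpose_mul]
    calc A * B * (T : SL(4, K)).1 * (B.transpose * A.transpose)
        = A * (B * (T : SL(4, K)).1 * B.transpose) * A.transpose := by simp only [mul_assoc]
      _ = _ := by rw [hB.form, hA.form]
  · have h2 : (2 : K) = 0 := CharTwo.two_eq_zero
    have ha := form_apply A (![0, 0, 1, 2] i) (![1, 2, 3, 3] i)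
    have hb := form_apply B.transpose (![0, 0, 1, 2] j) (![1, 2, 3, 3] j)
    rw [hA.form] at ha
    rw [hB.form'] at hb
    have hT : ∀ k : Fin 4, (T : SL(4, K)).1 (![0, 0, 1, 2] k) (![1, 2, 3, 3] k) = 0 := by
      intro k; fin_cases k <;> simp [T]
    rw [hT] at ha hb
    simp only [Matrix.transpose_apply] at hb
    simp only [Matrix.mul_apply, Fin.sum_univ_four, map_add, map_mul, ← hA.minor, ← hB.minor]
    simp only [Matrix.cons_val]
    generalize (![0, 0, 1, 2] : Fin 4 → Fin 4) i = a at *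
    generalize (![1, 2, 3, 3] : Fin 4 → Fin 4) i = b at *
    generalize (![0, 0, 1, 2] : Fin 4 → Fin 4) j = c at *
    generalize (![1, 2, 3, 3] : Fin 4 → Fin 4) j = d at *
    have ha' : (A a 0 * A b 3 - A a 3 * A b 0) + (A a 1 * A b 2 - A a 2 * A b 1) = 0 := by
      linear_combination -ha - (A a 3 * A b 0 + A a 2 * A b 1) * h2
    have hb' : (B 0 c * B 3 d - B 0 d * B 3 c) - (B 1 c * B 2 d - B 1 d * B 2 c) = 0 := by
      linear_combination -hb - (B 0 d * B 3 c + B 1 c * B 2 d) * h2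
    linear_combination (B 1 c * B 2 d - B 1 d * B 2 c) * ha' +
      (A a 0 * A b 3 - A a 3 * A b 0) * hb'

theorem one : IsTwisted θ (1 : Matrix (Fin 4) (Fin 4) K) := by
  refine ⟨by simp, fun i j ↦ ?_⟩
  fin_cases i <;> fin_cases j <;> simp [Matrix.one_apply]

end IsTwisted

theorem isTwisted_T [CharP K 2] (θ : K →+* K) : IsTwisted θ (T : SL(4, K)).1 := by
  refine ⟨?_, fun i j ↦ ?_⟩
  · rw [T_mul_T, one_mul]
    ext i j; fin_cases i <;> fin_cases j <;> simp [T]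
  · fin_cases i <;> fin_cases j <;> simp [T, CharTwo.neg_eq]

theorem isTwisted_S [CharP K 2] (θ : K →+* K) (m : ℕ) (hθ : ∀ x, θ x = x ^ 2 ^ (m + 1))
    (hθ2 : ∀ x, θ (θ x) = x ^ 2) (a b : K) : IsTwisted θ (S m a b).1 := by
  have h2 : (2 : K) = 0 := CharTwo.two_eq_zero
  simp only [S, ← hθ]
  refine ⟨?_, fun i j ↦ ?_⟩
  · ext i j
    rw [form_apply]
    fin_cases i <;> fin_cases j <;> simp [T] <;> grind
  · fin_cases i <;> fin_cases j <;> simp [hθ2] <;> grind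

theorem isTwisted_M [CharP K 2] (θ : K →+* K) (m : ℕ) (hθ : ∀ x, θ x = x ^ 2 ^ (m + 1))
    (hθ2 : ∀ x, θ (θ x) = x ^ 2) (c : Kˣ) : IsTwisted θ (M m c).1 := by
  have hc : (c : K) ≠ 0 := c.ne_zero
  have h1 : θ c = (c ^ 2 ^ m) ^ 2 := by rw [hθ, pow_succ, pow_mul]
  -- Since `θ ∘ θ` is squaring, `c ^ 2 ^ m` is the preimage of `c` under `θ`.
  have h3 : θ (c ^ 2 ^ m) = c := by
    exact θ.injective (by rw [hθ2, h1])
  simp only [M, pow_add, pow_one]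
  generalize (c : K) ^ 2 ^ m = d at *
  have hd : d ≠ 0 := by rintro rfl; simp at h1
  refine ⟨?_, fun i j ↦ ?_⟩
  · ext i j
    rw [form_apply]
    fin_cases i <;> fin_cases j <;> simp [T] <;> field_simp
  · fin_cases i <;> fin_cases j <;> simp [h1, h3] <;> field_simp

end

/-! ### The characteristic polynomial -/

theorem charpoly_fin_four {R : Type*} [CommRing R] (A : Matrix (Fin 4) (Fin 4) R) :
    A.charpoly = X ^ 4 - C A.trace * X ^ 3 +
      C ((A 0 0 * A 1 1 - A 0 1 * A 1 0) + (A 0 0 * A 2 2 - A 0 2 * A 2 0) +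
        (A 0 0 * A 3 3 - A 0 3 * A 3 0) + (A 1 1 * A 2 2 - A 1 2 * A 2 1) +
        (A 1 1 * A 3 3 - A 1 3 * A 3 1) + (A 2 2 * A 3 3 - A 2 3 * A 3 2)) * X ^ 2 -
      C A.adjugate.trace * X + C A.det := by
  simp only [Matrix.trace, Matrix.diag, Matrix.adjugate_fin_succ_eq_det_submatrix,
    Matrix.charpoly, Matrix.charmatrix, Matrix.det_succ_row_zero, Fin.sum_univ_succ]
  simp [Fin.succAbove, Matrix.det_fin_zero]
  ring

/-- The inverse `T gᵀ T` has the same trace as `g`. In the sum of principal 2-minors, four add up to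
`θ` of the trace, and the other two cancel by the form relations. -/
theorem IsTwisted.charpoly_eq {K : Type*} [Field K] [CharP K 2] {θ : K →+* K} {g : SL(4, K)}
    (hg : IsTwisted θ g.1) :
    g.1.charpoly = X ^ 4 - C g.1.trace * X ^ 3 + C (θ g.1.trace) * X ^ 2 - C g.1.trace * X + 1 := by
  have h2 : (2 : K) = 0 := CharTwo.two_eq_zero
  have hadj : g.1.adjugate = (T : SL(4, K)).1 * g.1.transpose * (T : SL(4, K)).1 := by
    have h := congrArg (· * g.1.adjugate) hg.inv_eq
    simpa [mul_assoc, Matrix.mul_adjugate, g.2] using h.symm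
  have htr : g.1.adjugate.trace = g.1.trace := by
    rw [hadj, Matrix.trace_mul_comm, ← mul_assoc, T_mul_T, one_mul, Matrix.trace_transpose]
  have hdet : g.1.det = 1 := g.2
  rw [charpoly_fin_four, htr, hdet, map_one]
  congr 4
  have e0 := form_apply g.1 0 3
  have e1 := form_apply g.1 1 2
  have e2 := form_apply g.1.transpose 0 3
  rw [hg.form] at e0 e1
  rw [hg.form'] at e2
  simp [T] at e0 e1 e2
  simp only [Matrix.trace, Matrix.diag, Fin.sum_univ_four, map_add, ← hg.minor]
  simp only [Matrix.cons_val]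
  grind

/-! ### Eigenvalues -/

theorem eq_or_mul_eq_one_of_add_inv_eq {F : Type*} [Field F] {x y : F} (hx : x ≠ 0) (hy : y ≠ 0)
    (h : x + x⁻¹ = y + y⁻¹) : x = y ∨ x * y = 1 := by
  have : (x - y) * (x * y - 1) = 0 := by
    field_simp at h
    linear_combination h
  rcases mul_eq_zero.mp this with h | h
  · exact .inl (sub_eq_zero.mp h)
  · exact .inr (sub_eq_zero.mp h)

theorem exists_add_inv_eq {F : Type*} [Field F] [IsAlgClosed F] (u : F) :
    ∃ x : F, x ≠ 0 ∧ x + x⁻¹ = u := by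
  obtain ⟨x, hx⟩ := IsAlgClosed.exists_root (X ^ 2 - C u * X + 1 : F[X]) (by
    have : (X ^ 2 - C u * X + 1 : F[X]).degree = 2 := by compute_degree!
    simp [this])
  simp only [IsRoot.def, eval_add, eval_sub, eval_pow, eval_X, eval_mul, eval_C, eval_one] at hx
  have hx0 : x ≠ 0 := by rintro rfl; simp at hx
  refine ⟨x, hx0, ?_⟩
  field_simp
  linear_combination hx

theorem pair_eq_of_add_eq_of_mul_eq {F : Type*} [Field F] {a b c d : F} (hs : a + b = c + d)
    (hp : a * b = c * d) : (a = c ∧ b = d) ∨ (a = d ∧ b = c) := by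
  have : (a - c) * (a - d) = 0 := by linear_combination a * hs - hp
  rcases mul_eq_zero.mp this with h | h
  · exact .inl ⟨by linear_combination h, by linear_combination hs - h⟩
  · exact .inr ⟨by linear_combination h, by linear_combination hs - h⟩

theorem eq_one_of_pow_two_mul_eq_one {F : Type*} [Field F] [CharP F 2] {x : F} {k N : ℕ}
    (h : x ^ (2 ^ k * N) = 1) : x ^ N = 1 := by
  rw [mul_comm, pow_mul] at h
  have := sub_pow_char_pow (p := 2) (n := k) (x ^ N) 1
  rw [h, one_pow, sub_self] at this
  exact sub_eq_zero.mp (pow_eq_zero_iff (by positivity) |>.mp this)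

/-- The relations among eigenvalues `α`, `β` forced by the twisted structure. -/
theorem pow_eq_one_of_twist {F : Type*} [Field F] [CharP F 2] {m : ℕ} {α β : F} (hα : α ≠ 0)
    (hβ : β ≠ 0)
    (h1 : α * β + (α * β)⁻¹ = α ^ 2 ^ (m + 1) + (α ^ 2 ^ (m + 1))⁻¹)
    (h2 : α * β⁻¹ + (α * β⁻¹)⁻¹ = β ^ 2 ^ (m + 1) + (β ^ 2 ^ (m + 1))⁻¹) :
    (α ^ (2 ^ (2 * m + 1) - 1) = 1 ∧ β ^ (2 ^ (2 * m + 1) - 1) = 1) ∨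
      (α ^ ((2 ^ (2 * m + 1)) ^ 2 + 1) = 1 ∧ β ^ ((2 ^ (2 * m + 1)) ^ 2 + 1) = 1) := by
  set r : ℕ := 2 ^ (m + 1) with hr
  have hr2 : r ^ 2 = 2 * 2 ^ (2 * m + 1) := by rw [hr]; ring
  have hr4 : r ^ 4 + 4 = 2 ^ 2 * ((2 ^ (2 * m + 1)) ^ 2 + 1) := by
    rw [show r ^ 4 = (r ^ 2) ^ 2 by ring, hr2]; ring
  generalize hq : 2 ^ (2 * m + 1) = q at *
  have hq1 : 1 ≤ q := hq ▸ Nat.one_le_two_pow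
  have key1 : ∀ x : F, x ≠ 0 → x ^ (r ^ 2) = x ^ 2 → x ^ (q - 1) = 1 := by
    intro x hx h
    apply eq_one_of_pow_two_mul_eq_one (k := 1)
    have : x ^ (2 ^ 1 * (q - 1)) * x ^ 2 = 1 * x ^ 2 := by
      rw [← pow_add, one_mul, ← h, hr2]; congr 1; omega
    exact mul_right_cancel₀ (pow_ne_zero _ hx) this
  have key2 : ∀ x : F, x ^ (r ^ 4 + 4) = 1 → x ^ (q ^ 2 + 1) = 1 := by
    intro x h
    rw [hr4] at h
    exact eq_one_of_pow_two_mul_eq_one h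
  have e4 : ∀ x : F, x ^ (r ^ 4 + 4) = (((x ^ r) ^ r) ^ r) ^ r * x ^ 4 := by
    intro x; ring
  have e2 : ∀ x : F, x ^ (r ^ 2) = (x ^ r) ^ r := by intro x; ring
  have hβi := inv_ne_zero hβ
  -- `α^r = (αβ)^±1` and `β^r = (α/β)^±1`. Equal signs give `x^(r^2) = x^2` for both eigenvalues,
  -- opposite signs `x^(r^4) = x^(-4)`; powers of 2 in the exponent then drop out, Frobenius being
  -- injective.
  rcases eq_or_mul_eq_one_of_add_inv_eq (mul_ne_zero hα hβ) (pow_ne_zero _ hα) h1 with a | a <;>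
  rcases eq_or_mul_eq_one_of_add_inv_eq (mul_ne_zero hα hβi) (pow_ne_zero _ hβ) h2 with b | b
  · left
    have ha : α ^ r = α * β := a.symm
    have hb : β ^ r = α * β⁻¹ := b.symm
    constructor <;> apply key1 _ ‹_› <;> rw [e2] <;>
      simp only [ha, hb, mul_pow, inv_pow] <;> field_simp
  · right
    have ha : α ^ r = α * β := a.symm
    have hb : β ^ r = α⁻¹ * β := by field_simp at b ⊢; linear_combination b
    constructor <;> apply key2 <;> rw [e4] <;>
      simp only [ha, hb, mul_pow, inv_pow] <;> field_simp
  · right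
    have ha : α ^ r = α⁻¹ * β⁻¹ := by field_simp at a ⊢; linear_combination a
    have hb : β ^ r = α * β⁻¹ := b.symm
    constructor <;> apply key2 <;> rw [e4] <;>
      simp only [ha, hb, mul_pow, inv_pow, mul_inv, inv_inv] <;> field_simp
  · left
    have ha : α ^ r = α⁻¹ * β⁻¹ := by field_simp at a ⊢; linear_combination a
    have hb : β ^ r = α⁻¹ * β := by field_simp at b ⊢; linear_combination b
    constructor <;> apply key1 _ ‹_› <;> rw [e2] <;>
      simp only [ha, hb, mul_pow, inv_pow, mul_inv, inv_inv] <;> field_simp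

theorem mul_dvd_of_pairwise_ne {F : Type*} [Field F] {a b c d : F} {p : F[X]} (ha : p.IsRoot a)
    (hb : p.IsRoot b) (hc : p.IsRoot c) (hd : p.IsRoot d) (hab : a ≠ b) (hac : a ≠ c) (had : a ≠ d)
    (hbc : b ≠ c) (hbd : b ≠ d) (hcd : c ≠ d) :
    (X - C a) * (X - C b) * (X - C c) * (X - C d) ∣ p := by
  have co : ∀ {x y : F}, x ≠ y → IsCoprime (X - C x) (X - C y) := fun h ↦
    isCoprime_X_sub_C_of_isUnit_sub (sub_ne_zero.mpr h).isUnit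
  have dv : ∀ {x : F}, p.IsRoot x → X - C x ∣ p := fun h ↦ dvd_iff_isRoot.mpr h
  exact (((co had).mul_left (co hbd)).mul_left (co hcd)).mul_dvd
    (((co hac).mul_left (co hbc)).mul_dvd ((co hab).mul_dvd (dv ha) (dv hb)) (dv hc)) (dv hd)

theorem dvd_X_pow_sub_one {F : Type*} [Field F] [IsAlgClosed F] [CharP F 2] {m : ℕ} {s : F}
    (hs0 : s ≠ 0) (hs : s ^ 2 ^ (2 * m + 1) = s) {f : F[X]}
    (hf : f = X ^ 4 - C s * X ^ 3 + C (s ^ 2 ^ (m + 1)) * X ^ 2 - C s * X + 1) :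
    f ∣ X ^ (2 ^ (2 * m + 1) - 1) - 1 ∨ f ∣ X ^ ((2 ^ (2 * m + 1)) ^ 2 + 1) - 1 := by
  have h2 : (2 : F) = 0 := CharTwo.two_eq_zero
  -- `α'` and `s^r / α'` are to be `α + α⁻¹` and `β + β⁻¹`: their sum is `s` and their product
  -- `s^r`.
  obtain ⟨α', hα', hα's⟩ : ∃ u : F, u ≠ 0 ∧ u + s ^ 2 ^ (m + 1) * u⁻¹ = s := by
    obtain ⟨x, hx⟩ := IsAlgClosed.exists_root (X ^ 2 - C s * X + C (s ^ 2 ^ (m + 1)) : F[X]) (by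
      have : (X ^ 2 - C s * X + C (s ^ 2 ^ (m + 1)) : F[X]).degree = 2 := by compute_degree!
      rw [this]; norm_num)
    simp only [IsRoot.def, eval_add, eval_sub, eval_pow, eval_X, eval_mul, eval_C] at hx
    have hx0 : x ≠ 0 := by
      rintro rfl
      simp [hs0] at hx
    refine ⟨x, hx0, ?_⟩
    field_simp
    linear_combination hx
  obtain ⟨α, hα, hαu⟩ := exists_add_inv_eq α'
  obtain ⟨β, hβ, hβu⟩ := exists_add_inv_eq (s ^ 2 ^ (m + 1) * α'⁻¹)
  have hsum : (α + α⁻¹) + (β + β⁻¹) = s := by rw [hαu, hβu, hα's]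
  have hprod : (α + α⁻¹) * (β + β⁻¹) = s ^ 2 ^ (m + 1) := by rw [hαu, hβu]; field_simp
  clear hβu hαu hα's hα' α'
  have hfact : f = (X - C α) * (X - C α⁻¹) * (X - C β) * (X - C β⁻¹) := by
    have h1 : C α * C α⁻¹ = (1 : F[X]) := by rw [← C_mul, mul_inv_cancel₀ hα, C_1]
    have h3 : C β * C β⁻¹ = (1 : F[X]) := by rw [← C_mul, mul_inv_cancel₀ hβ, C_1]
    have h2' : (2 : F[X]) = 0 := CharTwo.two_eq_zero
    rw [hf, ← hprod, ← hsum]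
    simp only [map_add, map_mul]
    generalize C α⁻¹ = α' at *
    generalize C β⁻¹ = β' at *
    grind
  -- In characteristic 2, `s ≠ 0` makes the four roots distinct, so divisibility can be tested root
  -- by root.
  have hne : α + α⁻¹ ≠ 0 ∧ β + β⁻¹ ≠ 0 := by
    rw [← mul_ne_zero_iff, hprod]; exact pow_ne_zero _ hs0
  have hne2 : α + α⁻¹ ≠ β + β⁻¹ := by
    intro h
    apply hs0
    rw [← hsum, h, CharTwo.add_self_eq_zero]
  have n1 : α ≠ α⁻¹ := fun h ↦ hne.1 (by rw [← h, CharTwo.add_self_eq_zero])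
  have n2 : β ≠ β⁻¹ := fun h ↦ hne.2 (by rw [← h, CharTwo.add_self_eq_zero])
  have n3 : α ≠ β := fun h ↦ hne2 (by rw [h])
  have n4 : α ≠ β⁻¹ := fun h ↦ hne2 (by rw [h, inv_inv, add_comm])
  have n5 : α⁻¹ ≠ β := fun h ↦ hne2 (by rw [← h, inv_inv, add_comm])
  have n6 : α⁻¹ ≠ β⁻¹ := fun h ↦ n3 (inv_injective h)
  have main : (α ^ (2 ^ (2 * m + 1) - 1) = 1 ∧ β ^ (2 ^ (2 * m + 1) - 1) = 1) ∨
      (α ^ ((2 ^ (2 * m + 1)) ^ 2 + 1) = 1 ∧ β ^ ((2 ^ (2 * m + 1)) ^ 2 + 1) = 1) := by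
    have frob : ∀ x y : F, (x + y) ^ 2 ^ (m + 1) = x ^ 2 ^ (m + 1) + y ^ 2 ^ (m + 1) :=
      fun x y ↦ add_pow_char_pow x y 2 _
    have hu : (α ^ 2 ^ (m + 1) + (α ^ 2 ^ (m + 1))⁻¹) + (β ^ 2 ^ (m + 1) + (β ^ 2 ^ (m + 1))⁻¹)
        = s ^ 2 ^ (m + 1) := by
      rw [← hsum]; simp only [frob, inv_pow]
    have hv : (α ^ 2 ^ (m + 1) + (α ^ 2 ^ (m + 1))⁻¹) * (β ^ 2 ^ (m + 1) + (β ^ 2 ^ (m + 1))⁻¹)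
        = s ^ 2 := by
      have : s ^ 2 = (s ^ 2 ^ (m + 1)) ^ 2 ^ (m + 1) := by
        rw [← pow_mul, ← pow_add, show m + 1 + (m + 1) = (2 * m + 1) + 1 by ring, pow_succ 2,
          pow_mul, hs]
      rw [this, ← hprod, mul_pow, frob, frob, inv_pow, inv_pow]
    have hsum' : (α * β + (α * β)⁻¹) + (α * β⁻¹ + (α * β⁻¹)⁻¹) = s ^ 2 ^ (m + 1) := by
      rw [← hprod]; field_simp; ring
    have hprod' : (α * β + (α * β)⁻¹) * (α * β⁻¹ + (α * β⁻¹)⁻¹) = s ^ 2 := by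
      have : (α * β + (α * β)⁻¹) * (α * β⁻¹ + (α * β⁻¹)⁻¹) =
          ((α + α⁻¹) + (β + β⁻¹)) ^ 2 - 2 * (2 + (α + α⁻¹) * (β + β⁻¹)) := by
        field_simp; ring
      rw [this, hsum, h2, zero_mul, sub_zero]
    rcases pair_eq_of_add_eq_of_mul_eq (hsum'.trans hu.symm) (hprod'.trans hv.symm)
      with ⟨h, h'⟩ | ⟨h, h'⟩
    · exact pow_eq_one_of_twist hα hβ h h'
    -- Replacing `β` by `β⁻¹` exchanges `αβ` and `αβ⁻¹`.
    · have := pow_eq_one_of_twist hα (inv_ne_zero hβ) h'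
        (by rw [inv_inv, h, inv_pow, inv_inv, add_comm])
      simpa only [inv_pow, inv_eq_one] using this
  rw [hfact]
  rcases main with ⟨h, h'⟩ | ⟨h, h'⟩ <;> [left; right] <;>
    exact mul_dvd_of_pairwise_ne (by simp [h]) (by simp [h]) (by simp [h']) (by simp [h'])
      n1 n3 n4 n5 n6 n2

/-! ### Restrictions on element orders -/

theorem pow_eq_one_of_charpoly_dvd {K L : Type*} [Field K] [Field L] [Algebra K L] {N : ℕ}
    {g : SL(4, K)} (h : g.1.charpoly.map (algebraMap K L) ∣ X ^ N - 1) : g ^ N = 1 := by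
  have h' : g.1.charpoly ∣ X ^ N - 1 := by
    rw [← Polynomial.map_dvd_map' (algebraMap K L)]
    simpa using h
  obtain ⟨Q, hQ⟩ := h'
  have := congrArg (aeval g.1) hQ
  rw [map_mul, Matrix.aeval_self_charpoly, zero_mul] at this
  apply Subtype.ext
  simpa [sub_eq_zero] using this

theorem IsTwisted.pow_eq_one {K : Type*} [Field K] [CharP K 2] {θ : K →+* K} {m : ℕ}
    (hθ : ∀ x, θ x = x ^ 2 ^ (m + 1)) (hK : ∀ x : K, x ^ 2 ^ (2 * m + 1) = x) {g : SL(4, K)}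
    (hg : IsTwisted θ g.1) :
    g ^ 4 = 1 ∨ g ^ (2 ^ (2 * m + 1) - 1) = 1 ∨ g ^ ((2 ^ (2 * m + 1)) ^ 2 + 1) = 1 := by
  have hc := hg.charpoly_eq
  by_cases hs : g.1.trace = 0
  · left
    apply pow_eq_one_of_charpoly_dvd (L := K)
    rw [hc, hs, CharTwo.sub_eq_add (X ^ 4 : K[X]) 1]
    simp
  · right
    have : CharP (AlgebraicClosure K) 2 := charP_of_injective_algebraMap' K 2
    have := dvd_X_pow_sub_one (F := AlgebraicClosure K) (m := m)
      (s := algebraMap K (AlgebraicClosure K) g.1.trace) (by simpa using hs)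
      (by rw [← map_pow, hK]) (f := g.1.charpoly.map (algebraMap K (AlgebraicClosure K)))
      (by rw [hc, hθ]; simp)
    exact this.imp pow_eq_one_of_charpoly_dvd pow_eq_one_of_charpoly_dvd

theorem isTwisted_of_mem_Sz {m : ℕ}
    (hK : ∀ x : GaloisField 2 (2 * m + 1), x ^ 2 ^ (2 * m + 1) = x)
    {g : SL(4, GaloisField 2 (2 * m + 1))} (hg : g ∈ Sz (2 * m + 1)) :
    IsTwisted (iterateFrobenius (GaloisField 2 (2 * m + 1)) 2 (m + 1)) g.1 := by
  have hθ := iterateFrobenius_def (R := GaloisField 2 (2 * m + 1)) 2 (m + 1)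
  have hθ2 : ∀ x, iterateFrobenius (GaloisField 2 (2 * m + 1)) 2 (m + 1)
      (iterateFrobenius (GaloisField 2 (2 * m + 1)) 2 (m + 1) x) = x ^ 2 := by
    intro x
    rw [hθ, hθ, ← pow_mul, ← pow_add, show m + 1 + (m + 1) = (2 * m + 1) + 1 by ring, pow_succ 2,
      pow_mul, hK]
  -- In a finite group the generated submonoid is already the subgroup, so inverses need no check.
  rw [Sz, ← Subgroup.mem_toSubmonoid, Subgroup.closure_toSubmonoid_of_finite] at hg
  induction hg using Submonoid.closure_induction with
  | mem x hx =>
    rw [show (2 * m + 1) / 2 = m by omega] at hx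
    rcases hx with (⟨a, b, rfl⟩ | ⟨c, rfl⟩) | rfl
    · exact isTwisted_S _ m hθ hθ2 a b
    · exact isTwisted_M _ m hθ hθ2 c
    · exact isTwisted_T _
  | one => exact IsTwisted.one
  | mul x y _ _ hx hy => exact hx.mul hy

theorem orderOf_dvd {n : ℕ} (hn : Odd n) (g : Sz n) :
    orderOf g ∣ 4 ∨ orderOf g ∣ 2 ^ n - 1 ∨ orderOf g ∣ (2 ^ n) ^ 2 + 1 := by
  obtain ⟨m, rfl⟩ := hn
  have hK : ∀ x : GaloisField 2 (2 * m + 1), x ^ 2 ^ (2 * m + 1) = x := by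
    intro x
    have := Fintype.ofFinite (GaloisField 2 (2 * m + 1))
    rw [← GaloisField.card 2 (2 * m + 1) (by omega), Nat.card_eq_fintype_card,
      FiniteField.pow_card]
  rw [← Subgroup.orderOf_coe]
  simp only [orderOf_dvd_iff_pow_eq_one]
  exact (isTwisted_of_mem_Sz hK g.2).pow_eq_one (iterateFrobenius_def 2 (m + 1)) hK

/-- For odd `n`, `2^n ≡ 2 mod 3`, so `2^n - 1` and `2^(2n) + 1` are prime to 3; both divide `2^(4n)
- 1`. -/
theorem dvd_two_pow_four_mul_sub_one {n k : ℕ} (hn : Odd n)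
    (h : k ∣ 4 ∨ k ∣ 2 ^ n - 1 ∨ k ∣ (2 ^ n) ^ 2 + 1) :
    k ∣ 4 ∨ (k ∣ 2 ^ (4 * n) - 1 ∧ ¬ 3 ∣ k) := by
  refine h.imp_right fun h ↦ ?_
  have h1 : 1 ≤ 2 ^ n := Nat.one_le_two_pow
  have hmod : 2 ^ n % 3 = 2 := by
    obtain ⟨m, rfl⟩ := hn
    simp [pow_succ, pow_mul, Nat.mul_mod, Nat.pow_mod]
  have hfac : 2 ^ (4 * n) - 1 = (2 ^ n - 1) * (2 ^ n + 1) * ((2 ^ n) ^ 2 + 1) := by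
    rw [mul_comm 4 n, pow_mul]
    generalize 2 ^ n = x at *
    zify [h1, Nat.one_le_pow 4 x h1]
    ring
  rw [hfac]
  rcases h with h | h
  · refine ⟨Dvd.dvd.mul_right (h.mul_right _) _, fun h3 ↦ ?_⟩
    have := h3.trans h
    omega
  · refine ⟨h.mul_left _, fun h3 ↦ ?_⟩
    have := Nat.mod_eq_zero_of_dvd (h3.trans h)
    simp [Nat.add_mod, Nat.pow_mod, hmod] at this

theorem mem_of_dvd_of_dvd {p q k : ℕ} (hpq : p.Coprime q)
    (hp : k ∣ 4 ∨ (k ∣ 2 ^ (4 * p) - 1 ∧ ¬ 3 ∣ k)) (hq : k ∣ 4 ∨ (k ∣ 2 ^ (4 * q) - 1 ∧ ¬ 3 ∣ k)) :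
    k ∈ ({1, 2, 4, 5} : Set ℕ) := by
  have h4 : k ∣ 4 → k ∈ ({1, 2, 4, 5} : Set ℕ) := by
    intro h
    have := Nat.le_of_dvd (by norm_num) h
    interval_cases k <;> simp_all
  rcases hp with hp | ⟨hp, h3⟩
  · exact h4 hp
  rcases hq with hq | ⟨hq, -⟩
  · exact h4 hq
  have h := Nat.dvd_gcd hp hq
  rw [Nat.pow_sub_one_gcd_pow_sub_one, Nat.gcd_mul_left, hpq.gcd_eq_one] at h
  norm_num at h
  have := Nat.le_of_dvd (by norm_num) h
  interval_cases k <;> simp_all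

/-! ### Elements of orders 2, 4 and 5 -/

section
variable {K : Type*} [Field K]

theorem orderOf_T : orderOf (T : SL(4, K)) = 2 := by
  apply orderOf_eq_prime
  · apply Subtype.ext
    rw [pow_two]
    exact T_mul_T
  · intro h
    have := congrFun (congrFun (congrArg Subtype.val h) 0) 0
    simp [T] at this

theorem orderOf_S_one_zero [CharP K 2] (m : ℕ) : orderOf (S m 1 0 : SL(4, K)) = 4 := by
  have h2 : (2 : K) = 0 := CharTwo.two_eq_zero
  have hsq : ((S m 1 0 : SL(4, K)) ^ 2).1 =
      !![1, 0, 0, 0; 0, 1, 0, 0; 1, 0, 1, 0; 1, 1, 0, 1] := by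
    rw [pow_two, Matrix.SpecialLinearGroup.coe_mul]
    ext i j
    fin_cases i <;> fin_cases j <;>
      simp [S, Matrix.mul_apply, Fin.sum_univ_four] <;> grind
  refine orderOf_eq_prime_pow (p := 2) (n := 1) (fun h ↦ ?_) ?_
  · rw [pow_one] at h
    rw [h] at hsq
    have := congrFun (congrFun hsq 2) 0
    simp at this
  · apply Subtype.ext
    rw [show 2 ^ (1 + 1) = 2 * 2 by rfl, pow_mul, pow_two (_ ^ 2), Matrix.SpecialLinearGroup.coe_mul]
    rw [hsq]
    ext i j
    fin_cases i <;> fin_cases j <;>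
      simp [Matrix.mul_apply, Fin.sum_univ_four] <;> grind

theorem orderOf_S_zero_one_mul_T [CharP K 2] (m : ℕ) : orderOf (S m 0 1 * T : SL(4, K)) = 5 := by
  have h2 : (2 : K) = 0 := CharTwo.two_eq_zero
  have : Fact (Nat.Prime 5) := ⟨by norm_num⟩
  have h1 : (S m 0 1 * T : SL(4, K)).1 =
      !![0, 0, 0, 1; 0, 0, 1, 0; 0, 1, 0, 1; 1, 0, 1, 1] := by
    rw [Matrix.SpecialLinearGroup.coe_mul]
    ext i j
    fin_cases i <;> fin_cases j <;> simp [S, T, Matrix.mul_apply, Fin.sum_univ_four]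
  have hsq : ((S m 0 1 * T : SL(4, K)) ^ 2).1 =
      !![1, 0, 1, 1; 0, 1, 0, 1; 1, 0, 0, 1; 1, 1, 1, 1] := by
    rw [pow_two, Matrix.SpecialLinearGroup.coe_mul, h1]
    ext i j
    fin_cases i <;> fin_cases j <;> simp [Matrix.mul_apply, Fin.sum_univ_four] <;> grind
  apply orderOf_eq_prime
  · apply Subtype.ext
    rw [show 5 = 2 + 2 + 1 by rfl, pow_add, pow_add, pow_one]
    rw [Matrix.SpecialLinearGroup.coe_mul, Matrix.SpecialLinearGroup.coe_mul, hsq, h1]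
    ext i j
    fin_cases i <;> fin_cases j <;> simp [Matrix.mul_apply, Fin.sum_univ_four] <;> grind
  · intro h
    rw [h] at h1
    have := congrFun (congrFun h1 0) 0
    simp at this

end

theorem subset_elementOrders_Sz (n : ℕ) : {1, 2, 4, 5} ⊆ elementOrders (Sz n) := by
  have hS : ∀ a b, S (n / 2) a b ∈ Sz n := fun a b ↦
    Subgroup.subset_closure (.inl (.inl ⟨a, b, rfl⟩))
  have hT : T ∈ Sz n := Subgroup.subset_closure (.inr rfl)
  rintro k (rfl | rfl | rfl | rfl)
  · exact ⟨1, orderOf_one⟩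
  · exact ⟨⟨T, hT⟩, (Subgroup.orderOf_mk _ _).trans orderOf_T⟩
  · exact ⟨⟨_, hS 1 0⟩, (Subgroup.orderOf_mk _ _).trans (orderOf_S_one_zero _)⟩
  · exact ⟨⟨_, mul_mem (hS 0 1) hT⟩, (Subgroup.orderOf_mk _ _).trans (orderOf_S_zero_one_mul_T _)⟩

end Suzuki

theorem mainTheorem3 (p q : ℕ) (hp : p.Prime) (hq : q.Prime) (hp2 : Odd p) (hq2 : Odd q)
    (hpq : p ≠ q) :
    elementOrders (Sz p) ∩ elementOrders (Sz q) = {1, 2, 4, 5} := by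
  apply Set.Subset.antisymm
  · rintro k ⟨⟨g, hg⟩, ⟨h, hh⟩⟩
    exact Suzuki.mem_of_dvd_of_dvd ((Nat.coprime_primes hp hq).mpr hpq)
      (Suzuki.dvd_two_pow_four_mul_sub_one hp2 (hg ▸ Suzuki.orderOf_dvd hp2 g))
      (Suzuki.dvd_two_pow_four_mul_sub_one hq2 (hh ▸ Suzuki.orderOf_dvd hq2 h))
  · exact Set.subset_inter (Suzuki.subset_elementOrders_Sz p) (Suzuki.subset_elementOrders_Sz q)
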